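/- \textbf{Setting.} Let $H$ be an infinite-dimensional real separable Hilbert space and let $A\colon\mathcal D(A)\subset H\to H$ be a densely defined, self-adjoint, negative definite linear operator with compact inverse. Let $(e_i)_{i\ge1}$ be an orthonormal basis of $H$ with $-Ae_i=\lambda_ie_i$, where $0<\lambda_1\le\lambda_2\le\cdots$ and $\lambda_i\to\infty$. For $\gamma\in\mathbb R$ put $(-A)^{\gamma}x=\sum_i\lambda_i^{\gamma}\langle x,e_i\rangle e_i$, $\dot H^{\gamma}=\mathcal D((-A)^{\gamma/2})$ and $\|x\|_\gamma=\|(-A)^{\gamma/2}x\|$. Let $Q\colon H\to H$ be a bounded, self-adjoint, positive definite operator that commutes with $A$ and is such that $(-A)^{\frac{\beta-1}{2}}Q^{\frac12}$ is a Hilbert--Schmidt operator for some $\beta\in(0,1]$. Let $W^Q$ be a cylindrical $Q$-Wiener process on a filtered probability space $(\Omega,\mathcal F,\mathbb P;\{\mathcal F_t\}_{t\ge0})$, and let $X_0\in\dot H^{\max(2\beta,1)}$ be deterministic. Let $F\colon H\to H$ satisfy, for some $L_F<\lambda_1$, $$\langle\varphi_1-\varphi_2,F(\varphi_1)-F(\varphi_2)\rangle\le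 L_F\|\varphi_1-\varphi_2\|^2\qquad\forall\,\varphi_1,\varphi_2\in H.$$ Let $F$ be twice differentiable (it is enough that $F$ is G\^ateaux differentiable with $F'(\varphi)\in\mathcal L(H)$ and that $\varphi\mapsto(-A)^{-\eta}F'(\varphi)\psi_1$ is G\^ateaux differentiable for each $\psi_1$, its derivative at $\varphi$ in direction $\psi_2$ being bounded and bilinear in $(\psi_1,\psi_2)$ and written $(-A)^{-\eta}F''(\varphi)(\psi_1,\psi_2)$). Suppose that, with some constants $L$, $\delta\in[1,2)$, $\eta\in[0,1)$, $$\|F'(\varphi)\psi\|\le L\|\psi\|\quad(\varphi,\psi\in H),\qquad \|(-A)^{-\frac\delta2}F'(\varphi)\psi\|\le L(1+\|\varphi\|_1)\|\psi\|_{-1}\quad(\varphi\in\dot H^1,\ \psi\in H),$$ $$\|(-A)^{-\eta}F''(\varphi)(\psi_1,\psi_2)\|\le L\|\psi_1\|\|\psi_2\|\quad(\varphi,\psi_1,\psi_2\in H).$$ For $n\in\mathbb N$ let $H_n=\mathrm{span}\{e_1,\dots,e_n\}$, let $P_n\colon H\to H_n$ be the orthogonal projection, $A_n=AP_n$ and $E_n(t)=e^{tA_n}$.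 For $\tau>0$ and $t_m=m\tau$ let $Y^n_m$ be the exponential Euler scheme $$Y_{m+1}^n=E_n(\tau)Y_m^n+\tau E_n(\tau)P_nF(Y_m^n)+E_n(\tau)P_n\big(W^Q(t_{m+1})-W^Q(t_m)\big),\qquad Y_0^n=P_nX_0.$$ Write $Y_m^{n,x}$ for the same scheme started at $x\in H_n$, and $P_m\Phi(x)=\mathbb E[\Phi(Y_m^{n,x})]$. A probability measure $\mu$ on $(H_n,\mathcal B(H_n))$ is called invariant if $\int P_m\Phi\,d\mu=\int\Phi\,d\mu$ for all $m$ and all bounded Borel functions $\Phi\colon H_n\to\mathbb R$. \textbf{Theorem.} Let $\tau>0$ satisfy $4L^2\tau<\lambda_1-L_F$, that is, $\tau<\frac{\lambda_1-L_F}{4L^2}$ (any $\tau>0$ if $L=0$). Then $\{Y_m^n\}_m$ is a time-homogeneous Markov chain with respect to $\{\mathcal F_{t_m}\}_m$ with transition operators $(P_m)_m$, and it is ergodic with a unique invariant probability measure $\nu_\tau^n$: there is exactly one invariant probability measure $\nu_\tau^n$ on $H_n$, and for every $\Phi\in L^2(H_n,\nu_\tau^n)$ each $P_m\Phi$ lies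 in $L^2(H_n,\nu_\tau^n)$ and $$\lim_{M\to\infty}\frac1M\sum_{m=0}^{M-1}P_m\Phi=\int_{H_n}\Phi\,d\nu_\tau^n\qquad\text{in }L^2(H_n,\nu_\tau^n).$$ -/

import Mathlib

open MeasureTheory ProbabilityTheory Filter
open scoped NNReal ENNReal Topology RealInnerProductSpace

noncomputable section

namespace ExpEuler

variable {H : Type*} [NormedAddCommGroup H] [InnerProductSpace ℝ H] [CompleteSpace H]

/-! ### The linear operator -/

/-- `A` is a densely defined, self-adjoint, negative definite linear operator on `H`,
possibly unbounded, with a compact inverse. -/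
structure IsNegSelfAdjointCompactInv (A : H →ₗ.[ℝ] H) : Prop where
  dense_domain : Dense (A.domain : Set H)
  selfAdjoint : IsSelfAdjoint A
  negDef : ∀ x : A.domain, (x : H) ≠ 0 → ⟪A x, (x : H)⟫ < 0
  compact_inverse : ∃ K : H →L[ℝ] H, IsCompactOperator K ∧
    (∀ y : H, ∃ h : K y ∈ A.domain, A ⟨K y, h⟩ = y) ∧
    ∀ x : A.domain, K (A x) = x

/-- `(lam i, e i)`, `i = 0, 1, 2, …`, are the eigenpairs of `-A`, in increasing order, the
eigenvectors forming an orthonormal basis of `H`. Indices start at `0`: the number `lam 0` is the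
smallest eigenvalue, called `λ₁` in the usual numbering. -/
structure IsEigenSystem (A : H →ₗ.[ℝ] H) (lam : ℕ → ℝ) (e : HilbertBasis ℕ ℝ H) : Prop where
  eigen : ∀ i, ∃ h : e i ∈ A.domain, A ⟨e i, h⟩ = -(lam i • e i)
  mono : Monotone lam
  tendsto : Tendsto lam atTop atTop

/-- The fractional power `(-A)^γ x = ∑ᵢ λᵢ^γ ⟨eᵢ, x⟩ eᵢ`; the series converges exactly for
`x` with `MemHdot lam e (2 * γ) x`, hence for all `x` if `γ ≤ 0`. -/
def fracPow (lam : ℕ → ℝ) (e : HilbertBasis ℕ ℝ H) (γ : ℝ) (x : H) : H :=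
  ∑' i, (lam i ^ γ * ⟪e i, x⟫) • e i

/-- The elements of `H` that belong to `Ḣ^γ = D((-A)^(γ/2))`. -/
def MemHdot (lam : ℕ → ℝ) (e : HilbertBasis ℕ ℝ H) (γ : ℝ) (x : H) : Prop :=
  Summable fun i => lam i ^ γ * ⟪e i, x⟫ ^ 2

/-- The norm `‖x‖_γ = ‖(-A)^(γ/2) x‖` of `Ḣ^γ`. -/
def hdotNorm (lam : ℕ → ℝ) (e : HilbertBasis ℕ ℝ H) (γ : ℝ) (x : H) : ℝ :=
  ‖fracPow lam e (γ / 2) x‖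

/-! ### The noise -/

/-- The covariance operator: bounded, self-adjoint, positive definite, commuting with `A`, and such
that `(-A)^((β-1)/2) Q^(1/2)` is a Hilbert–Schmidt operator. The operator `S` is the (unique)
positive square root `Q^(1/2)`. -/
structure IsCovariance (A : H →ₗ.[ℝ] H) (lam : ℕ → ℝ) (e : HilbertBasis ℕ ℝ H) (β : ℝ)
    (Q : H →L[ℝ] H) : Prop where
  selfAdjoint : IsSelfAdjoint Q
  posDef : ∀ x : H, x ≠ 0 → 0 < ⟪Q x, x⟫
  commute : ∀ x : A.domain, ∃ h : Q (x : H) ∈ A.domain, A ⟨Q (x : H), h⟩ = Q (A x)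
  hilbertSchmidt : ∃ S : H →L[ℝ] H, S.IsPositive ∧ S ∘L S = Q ∧
    Summable fun i => ‖fracPow lam e ((β - 1) / 2) (S (e i))‖ ^ 2

/-- `W` is a cylindrical `Q`-Wiener process with respect to the filtration `ℱ`. As `W t` need not
take values in `H`, the process is given by its coordinates: `W t h` stands for `⟨W(t), h⟩`. -/
structure IsCylindricalWiener {Ω : Type*} {mΩ : MeasurableSpace Ω} (P : Measure Ω)
    (ℱ : Filtration ℝ≥0 mΩ) (Q : H →L[ℝ] H) (W : ℝ≥0 → H → Ω → ℝ) : Prop where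
  zero : ∀ h, ∀ᵐ ω ∂P, W 0 h ω = 0
  linear : ∀ (t : ℝ≥0) (a b : ℝ) (h k : H),
    ∀ᵐ ω ∂P, W t (a • h + b • k) ω = a * W t h ω + b * W t k ω
  adapted : ∀ t h, Measurable[ℱ t] (W t h)
  law_increment : ∀ (s t : ℝ≥0), s ≤ t → ∀ h,
    P.map (fun ω => W t h ω - W s h ω) = gaussianReal 0 ((t - s) * ⟪Q h, h⟫.toNNReal)
  indep_increment : ∀ (s t : ℝ≥0), s ≤ t →
    Indep (⨆ h, MeasurableSpace.comap (fun ω => W t h ω - W s h ω) inferInstance) (ℱ s) P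
  continuous_paths : ∀ h, ∀ᵐ ω ∂P, Continuous fun t => W t h ω

/-! ### The nonlinearity -/

/-- The conditions on `F`. Differentiability is meant in the sense of Gateaux, and the second
derivative may take its values in the larger space `Ḣ^(-2η)`, as it does for Nemytskii operators on
`L²`: `DF φ ψ` is `F'(φ)ψ`, and `D2F φ ψ₁ ψ₂` is `(-A)^(-η) F''(φ)(ψ₁, ψ₂)`. Every twice Fréchet
differentiable `F` that satisfies the three bounds is included. -/
structure IsNonlinearity (lam : ℕ → ℝ) (e : HilbertBasis ℕ ℝ H) (δ η L LF : ℝ)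
    (F : H → H) : Prop where
  oneSided : ∀ φ₁ φ₂ : H, ⟪φ₁ - φ₂, F φ₁ - F φ₂⟫ ≤ LF * ‖φ₁ - φ₂‖ ^ 2
  oneSided_lt : LF < lam 0
  deriv : ∃ (DF : H → H →L[ℝ] H) (D2F : H → H →L[ℝ] H →L[ℝ] H),
    (∀ φ ψ, HasLineDerivAt ℝ F (DF φ ψ) φ ψ) ∧
    (∀ φ ψ₁ ψ₂, HasLineDerivAt ℝ (fun x => fracPow lam e (-η) (DF x ψ₁)) (D2F φ ψ₁ ψ₂) φ ψ₂) ∧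
    (∀ φ ψ, ‖DF φ ψ‖ ≤ L * ‖ψ‖) ∧
    (∀ φ ψ, MemHdot lam e 1 φ → ‖fracPow lam e (-(δ / 2)) (DF φ ψ)‖
      ≤ L * (1 + hdotNorm lam e 1 φ) * hdotNorm lam e (-1) ψ) ∧
    (∀ φ ψ₁ ψ₂, ‖D2F φ ψ₁ ψ₂‖ ≤ L * ‖ψ₁‖ * ‖ψ₂‖)

/-! ### Spectral Galerkin method and exponential Euler scheme -/

/-- `H_n`, the span of the first `n` eigenvectors. -/
def galerkin (e : HilbertBasis ℕ ℝ H) (n : ℕ) : Submodule ℝ H :=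
  Submodule.span ℝ (Set.range fun i : Fin n => e i)

/-- The eigenvector `e i`, `i < n`, as an element of `H_n`. -/
def galerkinVec (e : HilbertBasis ℕ ℝ H) (n : ℕ) (i : Fin n) : galerkin e n :=
  ⟨e i, Submodule.subset_span ⟨i, rfl⟩⟩

/-- The projection `P_n : H → H_n`. -/
def galerkinProj (e : HilbertBasis ℕ ℝ H) (n : ℕ) (x : H) : galerkin e n :=
  ∑ i : Fin n, ⟪e i, x⟫ • galerkinVec e n i

/-- `A_n = A P_n` on `H_n`, that is, `A_n x = -∑_{i < n} λᵢ ⟨eᵢ, x⟩ eᵢ`. -/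
def galerkinOp (lam : ℕ → ℝ) (e : HilbertBasis ℕ ℝ H) (n : ℕ) :
    galerkin e n →L[ℝ] galerkin e n :=
  -∑ i : Fin n, lam i • (innerSL ℝ (galerkinVec e n i)).smulRight (galerkinVec e n i)

/-- The exponential of a bounded operator on a normed space. -/
def opExp {V : Type*} [NormedAddCommGroup V] [NormedSpace ℝ V] (T : V →L[ℝ] V) : V →L[ℝ] V :=
  NormedSpace.exp T

/-- `E_n(t) = exp(t A_n)`. -/
def galerkinSemigroup (lam : ℕ → ℝ) (e : HilbertBasis ℕ ℝ H) (n : ℕ) (t : ℝ) :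
    galerkin e n →L[ℝ] galerkin e n :=
  opExp (t • galerkinOp lam e n)

/-- `P_n (W(t) - W(s))`. -/
def projIncrement {Ω : Type*} (e : HilbertBasis ℕ ℝ H) (n : ℕ) (W : ℝ≥0 → H → Ω → ℝ)
    (s t : ℝ≥0) (ω : Ω) : galerkin e n :=
  ∑ i : Fin n, (W t (e i) ω - W s (e i) ω) • galerkinVec e n i

/-- The exponential Euler scheme with stepsize `τ`, started at `x ∈ H_n`. -/
def scheme {Ω : Type*} (lam : ℕ → ℝ) (e : HilbertBasis ℕ ℝ H) (n : ℕ) (F : H → H)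
    (W : ℝ≥0 → H → Ω → ℝ) (τ : ℝ≥0) (x : galerkin e n) : ℕ → Ω → galerkin e n
  | 0, _ => x
  | m + 1, ω =>
    let y := scheme lam e n F W τ x m ω
    galerkinSemigroup lam e n τ y
      + (τ : ℝ) • galerkinSemigroup lam e n τ (galerkinProj e n (F (y : H)))
      + galerkinSemigroup lam e n τ (projIncrement e n W (m * τ) ((m + 1) * τ) ω)

/-! ### Markov chains and ergodicity -/

section Chain

variable {E : Type*} [MeasurableSpace E] {Ω : Type*} {mΩ : MeasurableSpace Ω}

/-- The transition operators `P_m Φ(x) = 𝔼[Φ(Y_m^x)]` of a family of processes `Y x`, indexed by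
their initial values `x`. -/
def transition (P : Measure Ω) (Y : E → ℕ → Ω → E) (m : ℕ) (Φ : E → ℝ) (x : E) : ℝ :=
  ∫ ω, Φ (Y x m ω) ∂P

/-- `Z` is a time-homogeneous Markov chain, with respect to the σ-algebras `𝒢 m`, with transition
operators `T m`. -/
def IsMarkovChain (P : Measure Ω) (𝒢 : ℕ → MeasurableSpace Ω) (T : ℕ → (E → ℝ) → E → ℝ)
    (Z : ℕ → Ω → E) : Prop :=
  (∀ m, Measurable[𝒢 m] (Z m)) ∧
  ∀ Φ : E → ℝ, Measurable Φ → (∃ C, ∀ x, |Φ x| ≤ C) → ∀ m k,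
    P[fun ω => Φ (Z (m + k) ω) | 𝒢 m] =ᵐ[P] fun ω => T k Φ (Z m ω)

/-- `μ` is an invariant probability measure for the transition operators `T m`. -/
def IsInvariantProb (T : ℕ → (E → ℝ) → E → ℝ) (μ : Measure E) : Prop :=
  IsProbabilityMeasure μ ∧
  ∀ Φ : E → ℝ, Measurable Φ → (∃ C, ∀ x, |Φ x| ≤ C) → ∀ m,
    ∫ x, T m Φ x ∂μ = ∫ x, Φ x ∂μ

/-- Ergodicity with respect to `μ`: the time averages `M⁻¹ ∑_{m < M} P_m Φ` converge to `∫ Φ dμ`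
in `L²(μ)`, for every `Φ ∈ L²(μ)`. -/
def IsErgodicFor (T : ℕ → (E → ℝ) → E → ℝ) (μ : Measure E) : Prop :=
  ∀ Φ : E → ℝ, MemLp Φ 2 μ →
    (∀ m, MemLp (T m Φ) 2 μ) ∧
    Tendsto (fun M : ℕ => eLpNorm
      (fun x => ((M : ℝ)⁻¹ * ∑ m ∈ Finset.range M, T m Φ x) - ∫ y, Φ y ∂μ) 2 μ) atTop (𝓝 0)

end Chain

end ExpEuler

end

/-! One step of the scheme reads `Y_{m+1} = G(Y_m) + ξ_m` with `G(y) = E_n(τ)(y + τ P_n F(y))` and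
i.i.d. integrable noise `ξ_m`, each independent of the past. Everything follows from `G` being a
strict contraction of `H_n`.

Put `d = x - y` and `p = P_n(F x - F y)`. The one-sided condition bounds `⟪d, p⟫`, and the bound on
`F'` makes `F` `L`-Lipschitz, so `‖d + τp‖² ≤ (1 + 2τ L_F + τ²L²)‖d‖²`. The semigroup contributes
`exp(-τ λ₁)`. Hence `G` has Lipschitz constant `q = exp(τ(L_F + τL²/2 - λ₁))`, and the step size
condition gives `q < 1` (`norm_schemeDrift_sub_le`).

Existence: if each new noise variable is inserted innermost instead of outermost, the iterates
converge almost surely, and the law of the limit is invariant (`exists_invariant_stepOp`).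
Uniqueness: two copies driven by the same noise approach each other like `q^m`, so `P_m Φ(x)` tends
to `∫ Φ dν` for every invariant `ν` and every bounded uniformly continuous `Φ`
(`tendsto_transition`). Ergodicity: `P_m` is a contraction of `L²(ν)` (`eLpNorm_transition_le`), so
density extends this convergence to all of `L²(ν)`, even without averaging; time averages then
converge by Cesàro. -/

namespace ExpEuler

/-! ### Autoregressive chains with independent noise -/

section Autoregression

set_option linter.unusedSectionVars false

variable {E : Type*} [NormedAddCommGroup E] [MeasurableSpace E] [BorelSpace E]
  [SecondCountableTopology E]
  {Ω : Type*} {mΩ : MeasurableSpace Ω}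

/-- The processes `Y x`, started at `x`, solve the recursion `Y_{m+1} = G (Y_m) + ξ_m`, in which
the noise `ξ_m` has law `μ`, is known at time `m + 1` and independent of the past `𝒢 m`. -/
structure IsAutoregression (P : Measure Ω) (𝒢 : ℕ → MeasurableSpace Ω) (μ : Measure E)
    (G : E → E) (ξ : ℕ → Ω → E) (Y : E → ℕ → Ω → E) : Prop where
  mono : Monotone 𝒢
  le : ∀ m, 𝒢 m ≤ mΩ
  measurable_drift : Measurable G
  measurable_noise : ∀ m, Measurable[𝒢 (m + 1)] (ξ m)
  indep : ∀ m, Indep (MeasurableSpace.comap (ξ m) inferInstance) (𝒢 m) P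
  law : ∀ m, P.map (ξ m) = μ
  zero : ∀ x ω, Y x 0 ω = x
  succ : ∀ x m ω, Y x (m + 1) ω = G (Y x m ω) + ξ m ω

/-- The one-step transition operator `Φ ↦ 𝔼[Φ(G x + ξ)]`, where `ξ` has law `μ`. -/
noncomputable def stepOp (μ : Measure E) (G : E → E) (Φ : E → ℝ) (x : E) : ℝ :=
  ∫ u, Φ (G x + u) ∂μ

lemma measurable_stepOp {μ : Measure E} [SFinite μ] {G : E → E} (hG : Measurable G) {Φ : E → ℝ}
    (hΦ : Measurable Φ) : Measurable (stepOp μ G Φ) := by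
  have h : StronglyMeasurable (fun p : E × E => Φ (G p.1 + p.2)) :=
    (by fun_prop : Measurable _).stronglyMeasurable
  exact h.integral_prod_right'.measurable

lemma abs_stepOp_le {μ : Measure E} [IsProbabilityMeasure μ] {G : E → E} {Φ : E → ℝ} {C : ℝ}
    (hC : ∀ x, |Φ x| ≤ C) (x : E) : |stepOp μ G Φ x| ≤ C := by
  have h := norm_integral_le_of_norm_le_const (μ := μ) (f := fun u => Φ (G x + u)) (C := C)
    (ae_of_all _ fun u => hC _)
  simpa [stepOp] using h

/-- Freezing: an independent variable is integrated out of a conditional expectation. -/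
lemma condExp_indep_integral {Ω : Type*} {m mΩ : MeasurableSpace Ω} {P : Measure Ω}
    [IsProbabilityMeasure P] (hm : m ≤ mΩ) {μ : Measure E} {Z ξ : Ω → E}
    (hZ : Measurable[m] Z) (hξ : Measurable ξ)
    (hind : Indep (MeasurableSpace.comap ξ inferInstance) m P) (hlaw : P.map ξ = μ)
    {f : E × E → ℝ} (hf : Measurable f) {C : ℝ} (hC : ∀ p, |f p| ≤ C) :
    P[fun ω => f (Z ω, ξ ω) | m] =ᵐ[P] fun ω => ∫ u, f (Z ω, u) ∂μ := by
  have : IsProbabilityMeasure μ := hlaw ▸ Measure.isProbabilityMeasure_map hξ.aemeasurable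
  have hZ' : Measurable Z := hZ.mono hm le_rfl
  have hg : Measurable fun z => ∫ u, f (z, u) ∂μ :=
    (hf.stronglyMeasurable.integral_prod_right' (ν := μ)).measurable
  have hgC : ∀ z, |∫ u, f (z, u) ∂μ| ≤ C := fun z => by
    simpa using norm_integral_le_of_norm_le_const (μ := μ) (f := fun u => f (z, u)) (C := C)
      (ae_of_all _ fun u => hC _)
  have hfi : Integrable (fun ω => f (Z ω, ξ ω)) P :=
    Integrable.of_bound (hf.comp (hZ'.prodMk hξ)).aestronglyMeasurable C (ae_of_all _ fun ω => hC _)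
  have hgi : Integrable (fun ω => ∫ u, f (Z ω, u) ∂μ) P :=
    Integrable.of_bound (hg.comp hZ').aestronglyMeasurable C (ae_of_all _ fun ω => hgC _)
  refine (ae_eq_condExp_of_forall_setIntegral_eq hm hfi (fun s _ _ => hgi.integrableOn)
    (fun s hs _ => ?_) (hg.comp hZ).stronglyMeasurable.aestronglyMeasurable).symm
  have hs' := hm s hs
  let V : Ω → ℝ × E := fun ω => (s.indicator 1 ω, Z ω)
  have hsm : Measurable[m] (s.indicator (1 : Ω → ℝ)) :=
    Measurable.indicator (f := fun _ => 1) measurable_const hs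
  have hVm : Measurable[m] V := hsm.prodMk hZ
  have hV : Measurable V := hVm.mono hm le_rfl
  have hVξ : IndepFun V ξ P := by
    rw [IndepFun_iff_Indep]
    exact (indep_of_indep_of_le_right hind hVm.comap_le).symm
  have hmap := hVξ.map_prod_eq_prod_map_map hV.aemeasurable hξ.aemeasurable
  have : IsProbabilityMeasure (P.map V) := Measure.isProbabilityMeasure_map hV.aemeasurable
  let k : (ℝ × E) × E → ℝ := fun p => p.1.1 * f (p.1.2, p.2)
  have hk : Measurable k := by fun_prop
  have hint : Integrable k ((P.map V).prod μ) := by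
    rw [← hlaw, ← hmap, integrable_map_measure hk.aestronglyMeasurable (by fun_prop)]
    refine Integrable.of_bound (hk.comp (hV.prodMk hξ)).aestronglyMeasurable C
      (ae_of_all _ fun ω => ?_)
    by_cases h : ω ∈ s
    · simpa [k, V, h] using hC _
    · simpa [k, V, h] using (abs_nonneg _).trans (hC (Z ω, ξ ω))
  calc ∫ ω in s, ∫ u, f (Z ω, u) ∂μ ∂P
      = ∫ ω, ∫ u, k (V ω, u) ∂μ ∂P := by
        rw [← integral_indicator hs']
        refine integral_congr_ae (ae_of_all _ fun ω => ?_)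
        by_cases h : ω ∈ s <;> simp [k, V, h]
    _ = ∫ v, ∫ u, k (v, u) ∂μ ∂(P.map V) := by
        rw [integral_map hV.aemeasurable]
        exact (hk.stronglyMeasurable.integral_prod_right' (ν := μ)).aestronglyMeasurable
    _ = ∫ p, k p ∂((P.map V).prod μ) := (integral_prod _ hint).symm
    _ = ∫ ω, k (V ω, ξ ω) ∂P := by
        rw [← hlaw, ← hmap, integral_map (by fun_prop) hk.aestronglyMeasurable]
    _ = ∫ ω in s, f (Z ω, ξ ω) ∂P := by
        rw [← integral_indicator hs']
        refine integral_congr_ae (ae_of_all _ fun ω => ?_)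
        by_cases h : ω ∈ s <;> simp [k, V, h]

namespace IsAutoregression

variable {P : Measure Ω} [IsProbabilityMeasure P] {𝒢 : ℕ → MeasurableSpace Ω} {μ : Measure E}
  {G : E → E} {ξ : ℕ → Ω → E} {Y : E → ℕ → Ω → E}

lemma noise_measurable (h : IsAutoregression P 𝒢 μ G ξ Y) (m : ℕ) : Measurable (ξ m) :=
  (h.measurable_noise m).mono (h.le _) le_rfl

lemma isProbabilityMeasure_law (h : IsAutoregression P 𝒢 μ G ξ Y) : IsProbabilityMeasure μ :=
  h.law 0 ▸ Measure.isProbabilityMeasure_map (h.noise_measurable 0).aemeasurable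

lemma adapted (h : IsAutoregression P 𝒢 μ G ξ Y) (x : E) (m : ℕ) : Measurable[𝒢 m] (Y x m) := by
  induction m with
  | zero => simp only [funext (h.zero x)]; exact measurable_const
  | succ m ih =>
    simp only [funext (h.succ x m)]
    exact (h.measurable_drift.comp (ih.mono (h.mono m.le_succ) le_rfl)).add (h.measurable_noise m)

lemma measurable_process (h : IsAutoregression P 𝒢 μ G ξ Y) (x : E) (m : ℕ) :
    Measurable (Y x m) :=
  (h.adapted x m).mono (h.le m) le_rfl

lemma measurable_uncurry (h : IsAutoregression P 𝒢 μ G ξ Y) (m : ℕ) :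
    Measurable fun p : E × Ω => Y p.1 m p.2 := by
  induction m with
  | zero => simp only [h.zero]; exact measurable_fst
  | succ m ih =>
    simp only [h.succ]
    exact (h.measurable_drift.comp ih).add ((h.noise_measurable m).comp measurable_snd)

lemma condExp_succ (h : IsAutoregression P 𝒢 μ G ξ Y) (x : E) (m : ℕ) {Φ : E → ℝ}
    (hΦ : Measurable Φ) {C : ℝ} (hC : ∀ x, |Φ x| ≤ C) :
    P[fun ω => Φ (Y x (m + 1) ω) | 𝒢 m] =ᵐ[P] fun ω => stepOp μ G Φ (Y x m ω) := by
  have hG := h.measurable_drift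
  have := condExp_indep_integral (h.le m) (h.adapted x m) (h.noise_measurable m) (h.indep m)
    (h.law m) (f := fun p => Φ (G p.1 + p.2)) (by fun_prop) (fun p => hC _)
  simpa only [h.succ, stepOp] using this

/-- Conditioning on `𝒢 m` peels off the last step; iterated, this reduces statements about `P_m` to
the one-step operator. -/
lemma transition_succ (h : IsAutoregression P 𝒢 μ G ξ Y) (m : ℕ) {Φ : E → ℝ}
    (hΦ : Measurable Φ) {C : ℝ} (hC : ∀ x, |Φ x| ≤ C) (x : E) :
    transition P Y (m + 1) Φ x = transition P Y m (stepOp μ G Φ) x := by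
  rw [transition, ← integral_condExp (h.le m), integral_congr_ae (h.condExp_succ x m hΦ hC)]
  rfl

/-- Induction on the time lag `k` with `Φ` varying: the tower property through `𝒢 (m + k)` trades
the last step for `stepOp μ G Φ`. -/
lemma isMarkovChain (h : IsAutoregression P 𝒢 μ G ξ Y) (x : E) :
    IsMarkovChain P 𝒢 (transition P Y) (Y x) := by
  have := h.isProbabilityMeasure_law
  refine ⟨h.adapted x, fun Φ hΦ hb m k => ?_⟩
  induction k generalizing Φ with
  | zero =>
    obtain ⟨C, hC⟩ := hb
    have h1 : transition P Y 0 Φ = Φ := by ext y; simp [transition, h.zero]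
    rw [h1]
    refine (condExp_of_stronglyMeasurable (h.le m)
      (hΦ.comp (h.adapted x m)).stronglyMeasurable ?_).eventuallyEq
    exact Integrable.of_bound (hΦ.comp (h.measurable_process x m)).aestronglyMeasurable C
      (ae_of_all _ fun ω => hC _)
  | succ k ih =>
    obtain ⟨C, hC⟩ := hb
    have h1 := ih (stepOp μ G Φ) (measurable_stepOp h.measurable_drift hΦ) ⟨C, abs_stepOp_le hC⟩
    have h2 : P[P[fun ω => Φ (Y x (m + k + 1) ω) | 𝒢 (m + k)] | 𝒢 m] =ᵐ[P]
        P[fun ω => Φ (Y x (m + k + 1) ω) | 𝒢 m] :=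
      condExp_condExp_of_le (h.mono (Nat.le_add_right m k)) (h.le _)
    have h3 := condExp_congr_ae (m := 𝒢 m) (h.condExp_succ x (m + k) hΦ hC)
    filter_upwards [h1, h2, h3] with ω h1 h2 h3
    rw [← add_assoc, ← h2, h3, h1, h.transition_succ k hΦ hC]

lemma isInvariantProb_of_stepOp (h : IsAutoregression P 𝒢 μ G ξ Y) {ν : Measure E}
    [IsProbabilityMeasure ν]
    (hν : ∀ Φ : E → ℝ, Measurable Φ → (∃ C, ∀ x, |Φ x| ≤ C) →
      ∫ x, stepOp μ G Φ x ∂ν = ∫ x, Φ x ∂ν) :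
    IsInvariantProb (transition P Y) ν := by
  have := h.isProbabilityMeasure_law
  refine ⟨inferInstance, fun Φ hΦ hb m => ?_⟩
  induction m generalizing Φ with
  | zero => simp [transition, h.zero]
  | succ m ih =>
    obtain ⟨C, hC⟩ := hb
    simp only [h.transition_succ m hΦ hC]
    rw [ih _ (measurable_stepOp h.measurable_drift hΦ) ⟨C, abs_stepOp_le hC⟩, hν Φ hΦ ⟨C, hC⟩]

/-- Invariance tested on indicators says that a chain started from `ν`, independently of the noise,
has law `ν` at time `m`. This is what lets `P_m` act on a.e. classes and on unbounded functions in
`L²(ν)`. -/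
lemma measurePreserving (h : IsAutoregression P 𝒢 μ G ξ Y) {ν : Measure E}
    (hν : IsInvariantProb (transition P Y) ν) (m : ℕ) :
    MeasurePreserving (fun p : E × Ω => Y p.1 m p.2) (ν.prod P) ν := by
  have := hν.1
  have hY := h.measurable_uncurry m
  refine ⟨hY, ?_⟩
  have : IsProbabilityMeasure ((ν.prod P).map fun p : E × Ω => Y p.1 m p.2) :=
    Measure.isProbabilityMeasure_map hY.aemeasurable
  ext s hs
  have hΦ : Measurable (s.indicator (1 : E → ℝ)) := measurable_one.indicator hs
  have hb : ∀ x, |s.indicator (1 : E → ℝ) x| ≤ 1 := fun x => by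
    by_cases hx : x ∈ s <;> simp [hx]
  have hi := hν.2 _ hΦ ⟨1, hb⟩ m
  have hint : Integrable (fun p : E × Ω => s.indicator (1 : E → ℝ) (Y p.1 m p.2)) (ν.prod P) :=
    Integrable.of_bound (hΦ.comp hY).aestronglyMeasurable 1 (ae_of_all _ fun p => hb _)
  simp only [transition] at hi
  rw [← integral_prod _ hint, ← integral_map hY.aemeasurable hΦ.aestronglyMeasurable,
    integral_indicator_one hs, integral_indicator_one hs] at hi
  exact (measureReal_eq_measureReal_iff).1 hi

end IsAutoregression

end Autoregression

/-! ### An invariant measure, by backward iteration -/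

section Existence

/-- The sequence `u, ω 0, ω 1, …`. -/
def seqCons {E : Type*} (p : E × (ℕ → E)) : ℕ → E
  | 0 => p.1
  | i + 1 => p.2 i

lemma measurable_seqCons {E : Type*} [MeasurableSpace E] :
    Measurable (seqCons : E × (ℕ → E) → ℕ → E) := by
  refine measurable_pi_lambda _ fun i => ?_
  cases i with
  | zero => exact measurable_fst
  | succ i => exact (measurable_pi_apply i).comp measurable_snd

/-- Prepending an independent variable of law `μ` to an i.i.d. sequence gives an i.i.d. sequence; it
suffices to compare the measures of cylinder sets. -/
lemma measurePreserving_seqCons {E : Type*} [MeasurableSpace E] (μ : Measure E)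
    [IsProbabilityMeasure μ] :
    MeasurePreserving seqCons (μ.prod (Measure.infinitePi fun _ : ℕ => μ))
      (Measure.infinitePi fun _ : ℕ => μ) := by
  classical
  refine ⟨measurable_seqCons, Measure.eq_infinitePi _ fun s t ht => ?_⟩
  obtain ⟨N, hN⟩ : ∃ N, s ⊆ Finset.range (N + 1) :=
    ⟨s.sup id, fun i hi => Finset.mem_range_succ_iff.2 (Finset.le_sup (f := id) hi)⟩
  -- Padding with the whole space turns the index set into the interval `0, …, N`, where the shift
  -- by one is easy to express; the extra factors have measure one.
  let t' : ℕ → Set E := fun i => if i ∈ s then t i else Set.univ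
  have ht' : ∀ i, MeasurableSet (t' i) := fun i => by
    by_cases h : i ∈ s <;> simp [t', h, ht]
  have hpre : seqCons ⁻¹' (Set.pi s t) =
      t' 0 ×ˢ Set.pi (Finset.range N) (fun i => t' (i + 1)) := by
    ext p
    simp only [Set.mem_preimage, Set.mem_pi, Set.mem_prod, Finset.mem_coe, Finset.mem_range, t']
    constructor
    · intro h
      refine ⟨?_, fun i _ => ?_⟩
      · split_ifs with h0
        · exact h 0 h0
        · trivial
      · split_ifs with h0
        · exact h _ h0
        · trivial
    · rintro ⟨h0, h1⟩ i hi
      cases i with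
      | zero => simpa [hi, seqCons] using h0
      | succ i =>
        have := h1 i (by simpa using hN hi)
        simpa [hi, seqCons] using this
  rw [Measure.map_apply measurable_seqCons (MeasurableSet.pi s.countable_toSet fun i _ => ht i),
    hpre, Measure.prod_prod, Measure.infinitePi_pi _ fun i _ => ht' _, mul_comm,
    ← Finset.prod_range_succ' (fun i => μ (t' i)), ← Finset.prod_subset hN]
  · exact Finset.prod_congr rfl fun i hi => by simp [t', hi]
  · intro i _ hi
    simp [t', hi]

variable {E : Type*} [NormedAddCommGroup E]

/-- The backward iterates `G(… G(G 0 + ω (m - 1)) …) + ω 0`. -/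
def backward (G : E → E) : ℕ → (ℕ → E) → E
  | 0, _ => 0
  | m + 1, ω => G (backward G m fun i => ω (i + 1)) + ω 0

/-- The two iterates differ only in their innermost argument, `G 0 + ω m` against `0`, and `m`
applications of `G` then contract this difference. -/
lemma norm_backward_succ_sub_le {G : E → E} {q : ℝ} (hq : 0 ≤ q)
    (hG : ∀ x y, ‖G x - G y‖ ≤ q * ‖x - y‖) (m : ℕ) (ω : ℕ → E) :
    ‖backward G (m + 1) ω - backward G m ω‖ ≤ q ^ m * ‖G 0 + ω m‖ := by
  induction m generalizing ω with
  | zero => simp [backward]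
  | succ m ih =>
    calc ‖backward G (m + 1 + 1) ω - backward G (m + 1) ω‖
        = ‖G (backward G (m + 1) fun i => ω (i + 1)) - G (backward G m fun i => ω (i + 1))‖ := by
          exact congrArg norm (add_sub_add_right_eq_sub _ _ (ω 0))
      _ ≤ q * (q ^ m * ‖G 0 + ω (m + 1)‖) :=
          (hG _ _).trans (mul_le_mul_of_nonneg_left (ih _) hq)
      _ = q ^ (m + 1) * ‖G 0 + ω (m + 1)‖ := by ring

variable [MeasurableSpace E] [BorelSpace E] [SecondCountableTopology E]

lemma measurable_backward {G : E → E} (hG : Measurable G) (m : ℕ) : Measurable (backward G m) := by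
  induction m with
  | zero => exact measurable_const
  | succ m ih =>
    have h1 : Measurable fun ω : ℕ → E => fun i => ω (i + 1) :=
      measurable_pi_lambda _ fun i => measurable_pi_apply _
    exact (hG.comp (ih.comp h1)).add (measurable_pi_apply 0)

/-- The expected sum of the increments is at most a geometric series times `𝔼‖G 0 + u‖`. It is
finite, so almost surely the increments are summable and the iterates are Cauchy. -/
lemma ae_exists_tendsto_backward [CompleteSpace E] {μ : Measure E} [IsProbabilityMeasure μ]
    (hμ : Integrable id μ) {G : E → E} {q : ℝ} (hq : 0 ≤ q) (hq1 : q < 1)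
    (hG : ∀ x y, ‖G x - G y‖ ≤ q * ‖x - y‖) :
    ∀ᵐ ω ∂(Measure.infinitePi fun _ : ℕ => μ),
      ∃ l, Tendsto (fun m => backward G m ω) atTop (𝓝 l) := by
  have hint : Integrable (fun u => G 0 + u) μ := (integrable_const _).add hμ
  have hmeas : ∀ m : ℕ, Measurable fun ω : ℕ → E => ENNReal.ofReal (q ^ m) * ‖G 0 + ω m‖ₑ :=
    fun m => by fun_prop
  have hsum : ∫⁻ ω, ∑' m : ℕ, ENNReal.ofReal (q ^ m) * ‖G 0 + ω m‖ₑ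
      ∂(Measure.infinitePi fun _ : ℕ => μ) ≠ ∞ := by
    have h1 : ∀ m : ℕ, ∫⁻ ω, ENNReal.ofReal (q ^ m) * ‖G 0 + ω m‖ₑ
        ∂(Measure.infinitePi fun _ : ℕ => μ) =
        ENNReal.ofReal q ^ m * ∫⁻ u, ‖G 0 + u‖ₑ ∂μ := fun m => by
      rw [lintegral_const_mul _ (by fun_prop), ENNReal.ofReal_pow hq,
        ← (measurePreserving_eval_infinitePi (fun _ : ℕ => μ) m).lintegral_comp
          (f := fun u => ‖G 0 + u‖ₑ) (by fun_prop)]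
    rw [lintegral_tsum fun m => (hmeas m).aemeasurable]
    simp only [h1]
    rw [ENNReal.tsum_mul_right, ENNReal.tsum_geometric]
    refine ENNReal.mul_ne_top (ENNReal.inv_ne_top.2 ?_) hint.2.ne
    exact (tsub_pos_of_lt (by simpa using hq1)).ne'
  filter_upwards [ae_lt_top' (AEMeasurable.tsum fun m => (hmeas m).aemeasurable) hsum]
    with ω hω
  refine cauchySeq_tendsto_of_complete (cauchySeq_of_dist_le_of_summable
    (fun m => q ^ m * ‖G 0 + ω m‖) (fun m => ?_) ?_)
  · rw [dist_comm, dist_eq_norm]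
    exact norm_backward_succ_sub_le hq hG m ω
  · refine (ENNReal.summable_toReal hω.ne).congr fun m => ?_
    simp [ENNReal.toReal_mul, pow_nonneg hq]

/-- A contraction with additive integrable noise has an invariant probability measure. -/
lemma exists_invariant_stepOp [CompleteSpace E] {μ : Measure E} [IsProbabilityMeasure μ]
    (hμ : Integrable id μ) {G : E → E} {q : ℝ} (hq : 0 ≤ q) (hq1 : q < 1)
    (hG : ∀ x y, ‖G x - G y‖ ≤ q * ‖x - y‖) :
    ∃ ν : Measure E, IsProbabilityMeasure ν ∧ ∀ Φ : E → ℝ, Measurable Φ → (∃ C, ∀ x, |Φ x| ≤ C) →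
      ∫ x, stepOp μ G Φ x ∂ν = ∫ x, Φ x ∂ν := by
  have hGc : Continuous G :=
    (LipschitzWith.of_dist_le_mul (K := ⟨q, hq⟩) fun x y => by
      rw [dist_eq_norm, dist_eq_norm]; exact hG x y).continuous
  let ρ := Measure.infinitePi fun _ : ℕ => μ
  obtain ⟨Z, hZ, hlim⟩ := measurable_limit_of_tendsto_metrizable_ae
    (fun m => (measurable_backward hGc.measurable m).aemeasurable)
    (ae_exists_tendsto_backward hμ hq hq1 hG)
  have hcons : MeasurePreserving seqCons (μ.prod ρ) ρ := measurePreserving_seqCons μ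
  -- Letting `m → ∞` in the recursion for `backward` gives `Z(u, ω) = G(Z ω) + u`. The extended
  -- sequence again has law `ρ`, so this identity is the invariance of the law of `Z`.
  have hfix : ∀ᵐ p ∂(μ.prod ρ), Z (seqCons p) = G (Z p.2) + p.1 := by
    filter_upwards [hcons.quasiMeasurePreserving.ae hlim,
      Measure.quasiMeasurePreserving_snd.ae hlim] with p h1 h2
    have h3 : Tendsto (fun m => backward G (m + 1) (seqCons p)) atTop (𝓝 (G (Z p.2) + p.1)) :=
      ((hGc.tendsto _).comp h2).add_const _
    exact tendsto_nhds_unique ((tendsto_add_atTop_iff_nat 1).2 h1) h3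
  refine ⟨ρ.map Z, Measure.isProbabilityMeasure_map hZ.aemeasurable, fun Φ hΦ ⟨C, hC⟩ => ?_⟩
  have hmeas : Measurable fun p : E × (ℕ → E) => Φ (G (Z p.2) + p.1) :=
    hΦ.comp ((hGc.measurable.comp (hZ.comp measurable_snd)).add measurable_fst)
  rw [integral_map hZ.aemeasurable
      (measurable_stepOp hGc.measurable hΦ).aestronglyMeasurable,
    integral_map hZ.aemeasurable hΦ.aestronglyMeasurable]
  calc ∫ ω, stepOp μ G Φ (Z ω) ∂ρ = ∫ p : E × (ℕ → E), Φ (G (Z p.2) + p.1) ∂(μ.prod ρ) :=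
        (integral_prod_symm _ (Integrable.of_bound hmeas.aestronglyMeasurable C
          (ae_of_all _ fun p => hC _))).symm
    _ = ∫ p, Φ (Z (seqCons p)) ∂(μ.prod ρ) :=
        integral_congr_ae (hfix.mono fun p hp => congrArg Φ hp.symm)
    _ = ∫ ω, Φ (Z ω) ∂((μ.prod ρ).map seqCons) :=
        (integral_map hcons.measurable.aemeasurable (hΦ.comp hZ).aestronglyMeasurable).symm
    _ = ∫ ω, Φ (Z ω) ∂ρ := by rw [hcons.map_eq]

end Existence

/-! ### Uniqueness of the invariant measure and ergodicity -/

section Ergodicity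

set_option linter.unusedSectionVars false

variable {E : Type*} [NormedAddCommGroup E] [MeasurableSpace E] [BorelSpace E]
  [SecondCountableTopology E]
  {Ω : Type*} {mΩ : MeasurableSpace Ω} {P : Measure Ω} [IsProbabilityMeasure P]
  {𝒢 : ℕ → MeasurableSpace Ω} {μ : Measure E} {G : E → E} {ξ : ℕ → Ω → E} {Y : E → ℕ → Ω → E}

namespace IsAutoregression

/-- Synchronous coupling: both chains receive the same noise, which cancels in the difference. -/
lemma norm_sub_le (h : IsAutoregression P 𝒢 μ G ξ Y) {q : ℝ} (hq : 0 ≤ q)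
    (hG : ∀ x y, ‖G x - G y‖ ≤ q * ‖x - y‖) (x y : E) (m : ℕ) (ω : Ω) :
    ‖Y x m ω - Y y m ω‖ ≤ q ^ m * ‖x - y‖ := by
  induction m with
  | zero => simp [h.zero]
  | succ m ih =>
    rw [h.succ, h.succ, add_sub_add_right_eq_sub, pow_succ']
    exact (hG _ _).trans ((mul_le_mul_of_nonneg_left ih hq).trans_eq (by ring))

lemma integrable_comp (h : IsAutoregression P 𝒢 μ G ξ Y) {Φ : E → ℝ} (hΦ : Measurable Φ) {C : ℝ}
    (hC : ∀ x, |Φ x| ≤ C) (x : E) (m : ℕ) : Integrable (fun ω => Φ (Y x m ω)) P :=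
  Integrable.of_bound (hΦ.comp (h.measurable_process x m)).aestronglyMeasurable C
    (ae_of_all _ fun _ => hC _)

lemma measurable_transition (h : IsAutoregression P 𝒢 μ G ξ Y) {Φ : E → ℝ} (hΦ : Measurable Φ)
    (m : ℕ) : Measurable (transition P Y m Φ) :=
  ((hΦ.comp (h.measurable_uncurry m)).stronglyMeasurable.integral_prod_right' (ν := P)).measurable

lemma abs_transition_le {Φ : E → ℝ} {C : ℝ} (hC : ∀ x, |Φ x| ≤ C) (m : ℕ) (x : E) :
    |transition P Y m Φ x| ≤ C := by
  simpa [transition] using norm_integral_le_of_norm_le_const (μ := P)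
    (f := fun ω => Φ (Y x m ω)) (C := C) (ae_of_all _ fun _ => hC _)

lemma tendsto_transition_sub (h : IsAutoregression P 𝒢 μ G ξ Y) {q : ℝ} (hq : 0 ≤ q)
    (hq1 : q < 1) (hG : ∀ x y, ‖G x - G y‖ ≤ q * ‖x - y‖) {Φ : E → ℝ} (hΦ : UniformContinuous Φ)
    {C : ℝ} (hC : ∀ x, |Φ x| ≤ C) (x y : E) :
    Tendsto (fun m => transition P Y m Φ x - transition P Y m Φ y) atTop (𝓝 0) := by
  have hm := hΦ.continuous.measurable
  rw [Metric.tendsto_atTop]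
  intro ε hε
  obtain ⟨δ, hδ, hδε⟩ := Metric.uniformContinuous_iff.1 hΦ (ε / 2) (half_pos hε)
  have hlim : Tendsto (fun m : ℕ => q ^ m * ‖x - y‖) atTop (𝓝 0) := by
    simpa using (tendsto_pow_atTop_nhds_zero_of_lt_one hq hq1).mul_const ‖x - y‖
  obtain ⟨N, hN⟩ := (hlim.eventually (gt_mem_nhds hδ)).exists_forall_of_atTop
  refine ⟨N, fun m hmN => ?_⟩
  rw [dist_zero_right, transition, transition,
    ← integral_sub (h.integrable_comp hm hC x m) (h.integrable_comp hm hC y m)]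
  refine lt_of_le_of_lt ?_ (half_lt_self hε)
  simpa using norm_integral_le_of_norm_le_const (μ := P) (C := ε / 2)
    (f := fun ω => Φ (Y x m ω) - Φ (Y y m ω)) (ae_of_all _ fun ω => by
      rw [← dist_eq_norm]
      refine (hδε ?_).le
      rw [dist_eq_norm]
      exact (h.norm_sub_le hq hG x y m ω).trans_lt (hN m hmN))

/-- The transition operators forget their initial value. -/
lemma tendsto_transition (h : IsAutoregression P 𝒢 μ G ξ Y) {q : ℝ} (hq : 0 ≤ q)
    (hq1 : q < 1) (hG : ∀ x y, ‖G x - G y‖ ≤ q * ‖x - y‖) {ν : Measure E}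
    (hν : IsInvariantProb (transition P Y) ν) {Φ : E → ℝ} (hΦ : UniformContinuous Φ)
    {C : ℝ} (hC : ∀ x, |Φ x| ≤ C) (x : E) :
    Tendsto (fun m => transition P Y m Φ x) atTop (𝓝 (∫ y, Φ y ∂ν)) := by
  have := hν.1
  have hm := hΦ.continuous.measurable
  have hint : ∀ m, Integrable (transition P Y m Φ) ν := fun m =>
    Integrable.of_bound (h.measurable_transition hm m).aestronglyMeasurable C
      (ae_of_all _ fun y => abs_transition_le hC m y)
  -- By invariance `∫ Φ dν` is the `ν`-average of `P_m Φ(y)`, so the error is an average of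
  -- differences between two starting points.
  have heq : ∀ m, transition P Y m Φ x - ∫ y, Φ y ∂ν =
      ∫ y, (transition P Y m Φ x - transition P Y m Φ y) ∂ν := fun m => by
    rw [integral_sub (integrable_const _) (hint m), hν.2 Φ hm ⟨C, hC⟩ m]
    simp
  rw [← tendsto_sub_nhds_zero_iff]
  simp only [heq]
  have := tendsto_integral_of_dominated_convergence (μ := ν) (f := fun _ => (0 : ℝ))
    (F := fun m y => transition P Y m Φ x - transition P Y m Φ y) (fun _ => C + C)
    (fun m => (measurable_const.sub (h.measurable_transition hm m)).aestronglyMeasurable)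
    (integrable_const _)
    (fun m => ae_of_all _ fun y => (_root_.norm_sub_le _ _).trans
      (add_le_add (abs_transition_le hC m x) (abs_transition_le hC m y)))
    (ae_of_all _ fun y => h.tendsto_transition_sub hq hq1 hG hΦ hC x y)
  simpa using this

/-- Both integrals are the limit of `P_m Φ(0)` for compactly supported continuous `Φ`, and such
functions determine a finite measure on a proper space. -/
lemma invariant_unique [ProperSpace E] (h : IsAutoregression P 𝒢 μ G ξ Y) {q : ℝ} (hq : 0 ≤ q)
    (hq1 : q < 1) (hG : ∀ x y, ‖G x - G y‖ ≤ q * ‖x - y‖) {ν ν' : Measure E}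
    (hν : IsInvariantProb (transition P Y) ν) (hν' : IsInvariantProb (transition P Y) ν') :
    ν' = ν := by
  have := hν.1
  have := hν'.1
  refine Measure.ext_of_integral_eq_on_compactlySupported fun f => ?_
  have hf := f.hasCompactSupport.uniformContinuous_of_continuous f.continuous
  obtain ⟨C, hC⟩ := f.hasCompactSupport.exists_bound_of_continuous f.continuous
  exact tendsto_nhds_unique (h.tendsto_transition hq hq1 hG hν' hf hC 0)
    (h.tendsto_transition hq hq1 hG hν hf hC 0)

lemma aestronglyMeasurable_transition (h : IsAutoregression P 𝒢 μ G ξ Y) {ν : Measure E}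
    (hν : IsInvariantProb (transition P Y) ν) {Φ : E → ℝ} (hΦ : AEStronglyMeasurable Φ ν) (m : ℕ) :
    AEStronglyMeasurable (transition P Y m Φ) ν := by
  have := hν.1
  exact (hΦ.comp_measurePreserving (h.measurePreserving hν m)).integral_prod_right'

/-- `Φ` and `(x, ω) ↦ Φ(Y x m ω)` have the same `L²` norm by invariance, and averaging over `ω` does
not increase it, since `L¹` norms are at most `L²` norms under `P`. -/
lemma eLpNorm_transition_le (h : IsAutoregression P 𝒢 μ G ξ Y) {ν : Measure E}
    (hν : IsInvariantProb (transition P Y) ν) {Φ : E → ℝ} (hΦ : AEStronglyMeasurable Φ ν) (m : ℕ) :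
    eLpNorm (transition P Y m Φ) 2 ν ≤ eLpNorm Φ 2 ν := by
  have := hν.1
  have hpres := h.measurePreserving hν m
  have hcomp := hΦ.comp_measurePreserving hpres
  rw [← eLpNorm_comp_measurePreserving hΦ hpres]
  simp only [eLpNorm_eq_lintegral_rpow_enorm_toReal two_ne_zero ENNReal.ofNat_ne_top]
  refine ENNReal.rpow_le_rpow ?_ (by simp)
  rw [lintegral_prod _ (hcomp.enorm.pow_const _)]
  refine lintegral_mono_ae ?_
  filter_upwards [hcomp.prodMk_left] with x hx
  have h1 : ‖transition P Y m Φ x‖ₑ ≤ eLpNorm (fun ω => Φ (Y x m ω)) 2 P :=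
    (enorm_integral_le_lintegral_enorm _).trans
      (by rw [← eLpNorm_one_eq_lintegral_enorm]
          exact eLpNorm_le_eLpNorm_of_exponent_le (by norm_num) hx)
  calc ‖transition P Y m Φ x‖ₑ ^ (2 : ℝ≥0∞).toReal
      ≤ eLpNorm (fun ω => Φ (Y x m ω)) 2 P ^ (2 : ℝ≥0∞).toReal :=
        ENNReal.rpow_le_rpow h1 (by simp)
    _ = _ := by
        rw [eLpNorm_eq_lintegral_rpow_enorm_toReal two_ne_zero ENNReal.ofNat_ne_top,
          ← ENNReal.rpow_mul]
        simp

/-- Only almost everywhere: for unbounded functions, integrability over `ω` is known for `ν`-almost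
every starting point. -/
lemma transition_sub_ae (h : IsAutoregression P 𝒢 μ G ξ Y) {ν : Measure E}
    (hν : IsInvariantProb (transition P Y) ν) {Φ Ψ : E → ℝ} (hΦ : Integrable Φ ν)
    (hΨ : Integrable Ψ ν) (m : ℕ) :
    transition P Y m (Φ - Ψ) =ᵐ[ν] transition P Y m Φ - transition P Y m Ψ := by
  have := hν.1
  have hpres := h.measurePreserving hν m
  filter_upwards [(hpres.integrable_comp_of_integrable hΦ).prod_right_ae,
    (hpres.integrable_comp_of_integrable hΨ).prod_right_ae] with x hx hx'
  exact integral_sub hx hx'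

lemma tendsto_eLpNorm_transition_of_uniformContinuous (h : IsAutoregression P 𝒢 μ G ξ Y) {q : ℝ}
    (hq : 0 ≤ q) (hq1 : q < 1) (hG : ∀ x y, ‖G x - G y‖ ≤ q * ‖x - y‖) {ν : Measure E}
    (hν : IsInvariantProb (transition P Y) ν) {Φ : E → ℝ} (hΦ : UniformContinuous Φ) {C : ℝ}
    (hC : ∀ x, |Φ x| ≤ C) :
    Tendsto (fun m => eLpNorm (fun x => transition P Y m Φ x - ∫ y, Φ y ∂ν) 2 ν) atTop (𝓝 0) := by
  have := hν.1
  have hm := hΦ.continuous.measurable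
  set c := ∫ y, Φ y ∂ν
  have hlim : ∀ x, Tendsto (fun m => ‖transition P Y m Φ x - c‖ₑ ^ (2 : ℝ)) atTop (𝓝 0) :=
    fun x => by
      have h1 := (tendsto_sub_nhds_zero_iff.2 (h.tendsto_transition hq hq1 hG hν hΦ hC x)).enorm
      simpa using h1.ennrpow_const 2
  have hdom := tendsto_lintegral_of_dominated_convergence (μ := ν) (f := fun _ => 0)
    (F := fun m x => ‖transition P Y m Φ x - c‖ₑ ^ (2 : ℝ))
    (fun _ => ENNReal.ofReal (C + |c|) ^ (2 : ℝ))
    (fun m => (((h.measurable_transition hm m).sub_const c).enorm.pow_const _))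
    (fun m => ae_of_all _ fun x => by
      refine ENNReal.rpow_le_rpow ?_ zero_le_two
      rw [← ofReal_norm]
      exact ENNReal.ofReal_le_ofReal ((_root_.norm_sub_le _ _).trans
        (add_le_add (abs_transition_le hC m x) le_rfl)))
    (by simp) (ae_of_all _ hlim)
  simp only [lintegral_zero] at hdom
  simp only [eLpNorm_eq_lintegral_rpow_enorm_toReal two_ne_zero ENNReal.ofNat_ne_top]
  simpa using hdom.ennrpow_const (1 / 2)

/-- Convergence to equilibrium in `L²`. -/
lemma tendsto_eLpNorm_transition [ProperSpace E] (h : IsAutoregression P 𝒢 μ G ξ Y) {q : ℝ}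
    (hq : 0 ≤ q) (hq1 : q < 1) (hG : ∀ x y, ‖G x - G y‖ ≤ q * ‖x - y‖) {ν : Measure E}
    (hν : IsInvariantProb (transition P Y) ν) {Φ : E → ℝ} (hΦ : MemLp Φ 2 ν) :
    Tendsto (fun m => eLpNorm (fun x => transition P Y m Φ x - ∫ y, Φ y ∂ν) 2 ν) atTop (𝓝 0) := by
  have := hν.1
  rw [ENNReal.tendsto_nhds_zero]
  intro ε hε
  have hε3 : ε / 3 ≠ 0 := (ENNReal.div_pos hε.ne' (by norm_num)).ne'
  -- An `ε/3` argument: the two approximation errors are controlled by the `L²` contraction and by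
  -- `L¹ ≤ L²`, and the middle term by the convergence for `Ψ`.
  obtain ⟨Ψ, hΨs, hΨd, hΨc, hΨ⟩ := hΦ.exists_hasCompactSupport_eLpNorm_sub_le (by norm_num) hε3
  obtain ⟨C, hC⟩ := hΨs.exists_bound_of_continuous hΨc
  have hlim := h.tendsto_eLpNorm_transition_of_uniformContinuous hq hq1 hG hν
    (hΨs.uniformContinuous_of_continuous hΨc) hC
  have hΦi := hΦ.integrable (by norm_num)
  have hΨi := hΨ.integrable (by norm_num)
  filter_upwards [(ENNReal.tendsto_nhds_zero.1 hlim) (ε / 3) (pos_iff_ne_zero.2 hε3)] with m hm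
  have h1 : eLpNorm (transition P Y m (Φ - Ψ)) 2 ν ≤ ε / 3 :=
    (h.eLpNorm_transition_le hν (hΦ.sub hΨ).1 m).trans hΨd
  have h2 : eLpNorm (fun _ : E => ∫ y, (Ψ y - Φ y) ∂ν) 2 ν ≤ ε / 3 := by
    rw [eLpNorm_const _ two_ne_zero (NeZero.ne ν)]
    simp only [measure_univ, ENNReal.one_rpow, mul_one]
    calc ‖∫ y, (Ψ y - Φ y) ∂ν‖ₑ ≤ eLpNorm (Ψ - Φ) 1 ν := by
          rw [eLpNorm_one_eq_lintegral_enorm]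
          exact enorm_integral_le_lintegral_enorm _
      _ ≤ eLpNorm (Ψ - Φ) 2 ν := eLpNorm_le_eLpNorm_of_exponent_le (by norm_num) (hΨ.sub hΦ).1
      _ ≤ ε / 3 := by rw [eLpNorm_sub_comm]; exact hΨd
  have hsplit : (fun x => transition P Y m Φ x - ∫ y, Φ y ∂ν) =ᵐ[ν]
      (transition P Y m (Φ - Ψ) + fun x => transition P Y m Ψ x - ∫ y, Ψ y ∂ν)
        + fun _ => ∫ y, (Ψ y - Φ y) ∂ν := by
    filter_upwards [h.transition_sub_ae hν hΦi hΨi m] with x hx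
    simp only [Pi.add_apply, hx, Pi.sub_apply, integral_sub hΨi hΦi]
    ring
  have hm1 := h.aestronglyMeasurable_transition hν (hΦ.sub hΨ).1 m
  have hm2 : AEStronglyMeasurable (fun x => transition P Y m Ψ x - ∫ y, Ψ y ∂ν) ν :=
    (h.aestronglyMeasurable_transition hν hΨ.1 m).sub aestronglyMeasurable_const
  rw [eLpNorm_congr_ae hsplit]
  calc _ ≤ _ := eLpNorm_add_le (hm1.add hm2) aestronglyMeasurable_const (by norm_num)
    _ ≤ (ε / 3 + ε / 3) + ε / 3 :=
        add_le_add ((eLpNorm_add_le hm1 hm2 (by norm_num)).trans (add_le_add h1 hm)) h2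
    _ = ε := ENNReal.add_thirds ε

/-- By Minkowski the error of the time average is at most the Cesàro mean of the errors of the `P_m
Φ`, which tend to zero. -/
lemma isErgodicFor [ProperSpace E] (h : IsAutoregression P 𝒢 μ G ξ Y) {q : ℝ}
    (hq : 0 ≤ q) (hq1 : q < 1) (hG : ∀ x y, ‖G x - G y‖ ≤ q * ‖x - y‖) {ν : Measure E}
    (hν : IsInvariantProb (transition P Y) ν) : IsErgodicFor (transition P Y) ν := by
  have := hν.1
  intro Φ hΦ
  have hmem : ∀ m, MemLp (transition P Y m Φ) 2 ν := fun m =>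
    ⟨h.aestronglyMeasurable_transition hν hΦ.1 m,
      (h.eLpNorm_transition_le hν hΦ.1 m).trans_lt hΦ.2⟩
  refine ⟨hmem, ?_⟩
  set c := ∫ y, Φ y ∂ν
  have hmem' : ∀ m, MemLp (fun x => transition P Y m Φ x - c) 2 ν := fun m =>
    (hmem m).sub (memLp_const c)
  have hlim : Tendsto (fun m => (eLpNorm (fun x => transition P Y m Φ x - c) 2 ν).toReal) atTop
      (𝓝 0) := by
    exact (ENNReal.tendsto_toReal ENNReal.zero_ne_top).comp
      (h.tendsto_eLpNorm_transition hq hq1 hG hν hΦ)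
  have hces := ENNReal.tendsto_ofReal hlim.cesaro
  rw [ENNReal.ofReal_zero] at hces
  refine tendsto_of_tendsto_of_tendsto_of_le_of_le' tendsto_const_nhds hces
    (Eventually.of_forall fun _ => zero_le) ?_
  -- For `M > 0` the constant `c` can be distributed over the sum; for `M = 0` the sum is empty and
  -- `c` would be lost.
  filter_upwards [eventually_gt_atTop 0] with M hM
  have hM' : (M : ℝ) ≠ 0 := by positivity
  have heq : (fun x => (M : ℝ)⁻¹ * ∑ m ∈ Finset.range M, transition P Y m Φ x - c) =
      (M : ℝ)⁻¹ • ∑ m ∈ Finset.range M, fun x => transition P Y m Φ x - c := by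
    ext x
    simp only [Pi.smul_apply, Finset.sum_apply, smul_eq_mul, Finset.sum_sub_distrib,
      Finset.sum_const, Finset.card_range, nsmul_eq_mul]
    field_simp
  rw [heq, eLpNorm_const_smul, ENNReal.ofReal_mul (by positivity),
    ENNReal.ofReal_sum_of_nonneg fun _ _ => ENNReal.toReal_nonneg,
    Real.enorm_of_nonneg (by positivity)]
  gcongr
  refine (eLpNorm_sum_le (fun m _ => (hmem' m).1) (by norm_num)).trans_eq ?_
  exact Finset.sum_congr rfl fun m _ => (ENNReal.ofReal_toReal (hmem' m).2.ne).symm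

end IsAutoregression

end Ergodicity

/-! ### Spectral Galerkin spaces -/

section Galerkin

set_option linter.unusedSectionVars false

variable {H : Type*} [NormedAddCommGroup H] [InnerProductSpace ℝ H]

/-- A function with a Gateaux derivative bounded by `L` is `L`-Lipschitz. -/
lemma norm_sub_le_of_hasLineDerivAt {F : H → H} {DF : H → H → H} {L : ℝ}
    (hD : ∀ φ ψ, HasLineDerivAt ℝ F (DF φ ψ) φ ψ) (hL : ∀ φ ψ, ‖DF φ ψ‖ ≤ L * ‖ψ‖) (x y : H) :
    ‖F x - F y‖ ≤ L * ‖x - y‖ := by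
  have hd : ∀ t : ℝ, HasDerivAt (fun t : ℝ => F (y + t • (x - y)))
      (DF (y + t • (x - y)) (x - y)) t := by
    intro t
    have h0 := hD (y + t • (x - y)) (x - y)
    rw [HasLineDerivAt] at h0
    -- The line derivative lives at parameter `0` of a line based at `y + t • (x - y)`; the shift `s
    -- ↦ s - t` moves it to parameter `t` of the line based at `y`.
    have h1 := HasDerivAt.scomp_of_eq t (h := fun s : ℝ => s - t) h0
      ((hasDerivAt_id t).sub_const t) (by simp)
    rw [one_smul] at h1
    refine h1.congr_of_eventuallyEq (Eventually.of_forall fun s => ?_)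
    simp only [Function.comp_apply, add_assoc, ← add_smul]
    congr 3
    ring
  have := (convex_univ (𝕜 := ℝ) (E := ℝ)).norm_image_sub_le_of_norm_hasDerivWithin_le
    (fun t _ => (hd t).hasDerivWithinAt) (fun t _ => hL _ _) (Set.mem_univ 0) (Set.mem_univ 1)
  simpa using this

variable [CompleteSpace H] (e : HilbertBasis ℕ ℝ H) (n : ℕ)

instance finiteDimensional_galerkin : FiniteDimensional ℝ (galerkin e n) :=
  FiniteDimensional.span_of_finite ℝ (Set.finite_range _)

lemma orthonormal_galerkinVec : Orthonormal ℝ (galerkinVec e n) := by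
  have h : Orthonormal ℝ fun i : Fin n => e i := e.orthonormal.comp _ Fin.val_injective
  refine ⟨fun i => h.1 i, fun i j hij => h.2 hij⟩

lemma coe_galerkinProj (x : H) : (galerkinProj e n x : H) = ∑ i : Fin n, ⟪e i, x⟫ • e i := by
  simp [galerkinProj, galerkinVec]

lemma galerkinProj_eq_orthogonalProjection (x : H) :
    galerkinProj e n x = (galerkin e n).orthogonalProjectionOnto x := by
  have ho : Orthonormal ℝ fun i : Fin n => e i := e.orthonormal.comp _ Fin.val_injective
  refine Subtype.ext (Submodule.eq_starProjection_of_mem_of_inner_eq_zero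
    (galerkinProj e n x).2 fun w hw => ?_).symm
  rw [coe_galerkinProj]
  induction hw using Submodule.span_induction with
  | mem w hw =>
    obtain ⟨i, rfl⟩ := hw
    rw [inner_sub_left, real_inner_comm, ho.inner_left_fintype]
    simp
  | zero => simp
  | add u v _ _ hu hv => rw [inner_add_right, hu, hv, add_zero]
  | smul a u _ hu => rw [inner_smul_right, hu, mul_zero]

lemma sum_inner_galerkinVec (x : galerkin e n) :
    ∑ i : Fin n, ⟪e i, (x : H)⟫ • galerkinVec e n i = x := by
  have h := galerkinProj_eq_orthogonalProjection e n x
  rwa [Submodule.orthogonalProjectionOnto_mem_subspace_eq_self] at h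

variable (lam : ℕ → ℝ)

lemma galerkinOp_galerkinVec (i : Fin n) :
    galerkinOp lam e n (galerkinVec e n i) = (-lam i) • galerkinVec e n i := by
  simp [galerkinOp, orthonormal_iff_ite.1 (orthonormal_galerkinVec e n)]

lemma opExp_apply_of_eigenvector {V : Type*} [NormedAddCommGroup V] [NormedSpace ℝ V]
    [CompleteSpace V] {T : V →L[ℝ] V} {v : V} {c : ℝ} (h : T v = c • v) :
    opExp T v = Real.exp c • v := by
  have hpow : ∀ k : ℕ, (T ^ k) v = c ^ k • v := by
    intro k
    induction k with
    | zero => simp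
    | succ k ih =>
      rw [pow_succ', mul_apply_eq_comp, ih, map_smul, h, smul_smul, pow_succ]
  have h1 := (NormedSpace.exp_series_hasSum_exp' (𝕂 := ℝ) T).mapL (ContinuousLinearMap.apply ℝ V v)
  have h2 := (NormedSpace.exp_series_hasSum_exp' (𝕂 := ℝ) c).smul_const v
  rw [← Real.exp_eq_exp_ℝ] at h2
  refine h1.unique ?_
  simpa [hpow, smul_smul] using h2

lemma galerkinSemigroup_galerkinVec (t : ℝ) (i : Fin n) :
    galerkinSemigroup lam e n t (galerkinVec e n i) =
      Real.exp (-(t * lam i)) • galerkinVec e n i :=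
  opExp_apply_of_eigenvector (by simp [galerkinOp_galerkinVec, smul_smul])

/-- The eigenvectors diagonalize the semigroup, and by monotonicity `lam 0` gives the slowest decay.
-/
lemma norm_galerkinSemigroup_le {lam : ℕ → ℝ} (hlam : Monotone lam) {t : ℝ} (ht : 0 ≤ t)
    (x : galerkin e n) :
    ‖galerkinSemigroup lam e n t x‖ ≤ Real.exp (-(t * lam 0)) * ‖x‖ := by
  have ho := orthonormal_galerkinVec e n
  have hsq : ∀ c : Fin n → ℝ, ‖∑ i, c i • galerkinVec e n i‖ ^ 2 = ∑ i, c i ^ 2 := fun c => by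
    rw [← real_inner_self_eq_norm_sq, ho.inner_sum]
    simp [sq]
  refine abs_le_of_sq_le_sq' ?_ (by positivity) |>.2
  conv_lhs => rw [← sum_inner_galerkinVec e n x]
  conv_rhs => rw [← sum_inner_galerkinVec e n x]
  simp only [map_sum, map_smul, galerkinSemigroup_galerkinVec, smul_smul]
  rw [mul_pow, hsq, hsq, Finset.mul_sum]
  refine Finset.sum_le_sum fun i _ => ?_
  rw [mul_pow, mul_comm]
  gcongr
  exact hlam (Nat.zero_le _)

/-- The deterministic part of one step of the exponential Euler scheme. -/
noncomputable def schemeDrift (lam : ℕ → ℝ) (e : HilbertBasis ℕ ℝ H) (n : ℕ) (F : H → H) (τ : ℝ)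
    (y : galerkin e n) : galerkin e n :=
  galerkinSemigroup lam e n τ y
    + τ • galerkinSemigroup lam e n τ (galerkinProj e n (F (y : H)))

/-- The one-sided condition enters through the cross term of `‖d + τp‖²`, the Lipschitz bound only
through the term of order `τ²`. -/
lemma norm_schemeDrift_sub_le {lam : ℕ → ℝ} (hlam : Monotone lam) {F : H → H} {L LF τ : ℝ}
    (hτ : 0 ≤ τ) (hone : ∀ φ₁ φ₂ : H, ⟪φ₁ - φ₂, F φ₁ - F φ₂⟫ ≤ LF * ‖φ₁ - φ₂‖ ^ 2)
    (hLip : ∀ x y, ‖F x - F y‖ ≤ L * ‖x - y‖) (x y : galerkin e n) :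
    ‖schemeDrift lam e n F τ x - schemeDrift lam e n F τ y‖ ≤
      Real.exp (τ * (LF + τ * L ^ 2 / 2 - lam 0)) * ‖x - y‖ := by
  set d := x - y with hd
  set p := galerkinProj e n (F x) - galerkinProj e n (F y) with hp
  have hpo : p = (galerkin e n).orthogonalProjectionOnto (F x - F y) := by
    rw [hp, galerkinProj_eq_orthogonalProjection, galerkinProj_eq_orthogonalProjection, map_sub]
  have hdp : ⟪d, p⟫ ≤ LF * ‖d‖ ^ 2 := by
    -- Since `d` lies in `H_n`, the projection can be dropped in the inner product.
    rw [hpo, Submodule.inner_orthogonalProjectionOnto_eq_of_mem_left]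
    exact hone x y
  have hpn : ‖p‖ ^ 2 ≤ L ^ 2 * ‖d‖ ^ 2 := by
    rw [← mul_pow]
    refine pow_le_pow_left₀ (norm_nonneg _) ?_ 2
    rw [hpo]
    exact (Submodule.norm_orthogonalProjectionOnto_apply_le _ _).trans (hLip x y)
  have heq : schemeDrift lam e n F τ x - schemeDrift lam e n F τ y =
      galerkinSemigroup lam e n τ (d + τ • p) := by
    simp only [schemeDrift, hd, hp, map_add, map_sub, map_smul, smul_sub]
    abel
  have hstep : ‖d + τ • p‖ ≤ Real.exp (τ * LF + τ ^ 2 * L ^ 2 / 2) * ‖d‖ := by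
    refine abs_le_of_sq_le_sq' ?_ (by positivity) |>.2
    rw [norm_add_sq_real, inner_smul_right, norm_smul, mul_pow, mul_pow, ← Real.exp_nat_mul,
      Real.norm_eq_abs, sq_abs]
    -- Bounding `1 + 2τ L_F + τ²L²` by an exponential makes it combine with the semigroup factor.
    have h1 := Real.add_one_le_exp (2 * (τ * LF + τ ^ 2 * L ^ 2 / 2))
    have h2 := mul_le_mul_of_nonneg_right h1 (sq_nonneg ‖d‖)
    have h3 := mul_le_mul_of_nonneg_left hdp hτ
    have h4 := mul_le_mul_of_nonneg_left hpn (sq_nonneg τ)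
    push_cast
    linarith
  rw [heq]
  refine (norm_galerkinSemigroup_le e n hlam hτ _).trans
    ((mul_le_mul_of_nonneg_left hstep (Real.exp_nonneg _)).trans_eq ?_)
  rw [← mul_assoc, ← Real.exp_add]
  congr 2
  ring

end Galerkin

/-! ### The noise of the scheme -/

section Noise

set_option linter.unusedSectionVars false

variable {H : Type*} [NormedAddCommGroup H] [InnerProductSpace ℝ H]
  {Ω : Type*} {mΩ : MeasurableSpace Ω} {P : Measure Ω} [IsProbabilityMeasure P]
  {ℱ : Filtration ℝ≥0 mΩ} {Q : H →L[ℝ] H} {W : ℝ≥0 → H → Ω → ℝ}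

namespace IsCylindricalWiener

lemma ae_map_sum (hW : IsCylindricalWiener P ℱ Q W) (t : ℝ≥0) {ι : Type*} (s : Finset ι)
    (c : ι → ℝ) (v : ι → H) :
    ∀ᵐ ω ∂P, W t (∑ i ∈ s, c i • v i) ω = ∑ i ∈ s, c i * W t (v i) ω := by
  classical
  induction s using Finset.induction_on with
  | empty => simpa using hW.linear t 0 0 0 0
  | insert i s hi ih =>
    filter_upwards [ih, hW.linear t (c i) 1 (v i) (∑ i ∈ s, c i • v i)] with ω h1 h2
    rw [Finset.sum_insert hi, Finset.sum_insert hi, ← h1, ← one_smul ℝ (∑ i ∈ s, c i • v i), h2]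
    simp

variable [CompleteSpace H] [MeasurableSpace H] [BorelSpace H] (e : HilbertBasis ℕ ℝ H) (n : ℕ)

lemma measurable_projIncrement {m : MeasurableSpace Ω} {s t : ℝ≥0}
    (h : ∀ i : Fin n, Measurable[m] fun ω => W t (e i) ω - W s (e i) ω) :
    Measurable[m] (projIncrement e n W s t) := by
  have : SecondCountableTopology (galerkin e n) :=
    secondCountable_of_proper
  unfold projIncrement
  exact Finset.measurable_sum _ fun i _ => (h i).smul_const _

lemma adapted_increment (hW : IsCylindricalWiener P ℱ Q W) {s t : ℝ≥0} (hst : s ≤ t) (h : H) :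
    Measurable[ℱ t] fun ω => W t h ω - W s h ω :=
  (hW.adapted t h).sub ((hW.adapted s h).mono (ℱ.mono hst) le_rfl)

lemma adapted_projIncrement (hW : IsCylindricalWiener P ℱ Q W) {s t : ℝ≥0} (hst : s ≤ t) :
    Measurable[ℱ t] (projIncrement e n W s t) :=
  measurable_projIncrement e n fun _ => hW.adapted_increment hst _

lemma indep_projIncrement (hW : IsCylindricalWiener P ℱ Q W) {s t : ℝ≥0} (hst : s ≤ t) :
    Indep (MeasurableSpace.comap (projIncrement e n W s t) inferInstance) (ℱ s) P := by
  refine indep_of_indep_of_le_left (hW.indep_increment s t hst) ?_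
  refine Measurable.comap_le (measurable_projIncrement e n fun i => ?_)
  exact Measurable.mono (comap_measurable _)
    (le_iSup (fun h => MeasurableSpace.comap (fun ω => W t h ω - W s h ω) inferInstance) (e i))
    le_rfl

/-- The pairing of the projected increment with `x` is almost surely the scalar increment in
direction `x`, whose Gaussian law is given. Thus the law on `H_n` depends only on `t - s`. -/
lemma charFun_projIncrement (hW : IsCylindricalWiener P ℱ Q W) {s t : ℝ≥0} (hst : s ≤ t)
    (x : galerkin e n) :
    charFun (P.map (projIncrement e n W s t)) x =
      charFun (gaussianReal 0 ((t - s) * ⟪Q x, x⟫.toNNReal)) 1 := by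
  have hx : ∑ i : Fin n, ⟪e i, (x : H)⟫ • e i = (x : H) := by
    rw [← coe_galerkinProj]
    exact congrArg Subtype.val (sum_inner_galerkinVec e n x)
  have hm : Measurable (projIncrement e n W s t) :=
    (hW.adapted_projIncrement e n hst).mono (ℱ.le t) le_rfl
  have hm' : Measurable fun ω => W t x ω - W s x ω :=
    (hW.adapted_increment hst _).mono (ℱ.le t) le_rfl
  rw [← hW.law_increment s t hst, charFun_apply, charFun_apply,
    integral_map hm.aemeasurable (by fun_prop), integral_map hm'.aemeasurable (by fun_prop)]
  refine integral_congr_ae ?_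
  filter_upwards [hW.ae_map_sum t Finset.univ (fun i : Fin n => ⟪e i, (x : H)⟫) (fun i => e i),
    hW.ae_map_sum s Finset.univ (fun i : Fin n => ⟪e i, (x : H)⟫) (fun i => e i)] with ω h1 h2
  rw [hx] at h1 h2
  have : ⟪projIncrement e n W s t ω, x⟫ = W t x ω - W s x ω := by
    rw [h1, h2, projIncrement, sum_inner, ← Finset.sum_sub_distrib]
    refine Finset.sum_congr rfl fun i _ => ?_
    rw [inner_smul_left]
    simp only [conj_trivial, galerkinVec, Submodule.coe_inner]
    ring
  simp [this]

/-- The increments of a cylindrical Wiener process are stationary. -/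
lemma map_projIncrement_eq (hW : IsCylindricalWiener P ℱ Q W) {s t s' t' : ℝ≥0} (hst : s ≤ t)
    (hst' : s' ≤ t') (h : t - s = t' - s') :
    P.map (projIncrement e n W s t) = P.map (projIncrement e n W s' t') := by
  have h1 : IsProbabilityMeasure (P.map (projIncrement e n W s t)) :=
    Measure.isProbabilityMeasure_map
      ((hW.adapted_projIncrement e n hst).mono (ℱ.le t) le_rfl).aemeasurable
  have h2 : IsProbabilityMeasure (P.map (projIncrement e n W s' t')) :=
    Measure.isProbabilityMeasure_map
      ((hW.adapted_projIncrement e n hst').mono (ℱ.le t') le_rfl).aemeasurable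
  have : SecondCountableTopology (galerkin e n) := secondCountable_of_proper
  refine Measure.ext_of_charFun (funext fun x => ?_)
  rw [hW.charFun_projIncrement e n hst, hW.charFun_projIncrement e n hst', h]

lemma integrable_projIncrement (hW : IsCylindricalWiener P ℱ Q W) {s t : ℝ≥0} (hst : s ≤ t) :
    Integrable (projIncrement e n W s t) P := by
  unfold projIncrement
  refine integrable_finsetSum _ fun i _ => Integrable.smul_const ?_ _
  have hm : Measurable fun ω => W t (e i) ω - W s (e i) ω :=
    (hW.adapted_increment hst _).mono (ℱ.le t) le_rfl
  have h1 := (memLp_id_gaussianReal (μ := 0) (v := (t - s) * ⟪Q (e i), e i⟫.toNNReal) 1)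
  rw [← hW.law_increment s t hst] at h1
  exact (memLp_one_iff_integrable.1 (by simpa using h1)).comp_measurable hm

end IsCylindricalWiener

end Noise

/-! ### The exponential Euler scheme -/

lemma isAutoregression_scheme
    {H : Type*} [NormedAddCommGroup H] [InnerProductSpace ℝ H] [CompleteSpace H]
    [MeasurableSpace H] [BorelSpace H]
    {Ω : Type*} {mΩ : MeasurableSpace Ω} {P : Measure Ω} [IsProbabilityMeasure P]
    {ℱ : Filtration ℝ≥0 mΩ} {Q : H →L[ℝ] H} {W : ℝ≥0 → H → Ω → ℝ}
    (hW : IsCylindricalWiener P ℱ Q W) (lam : ℕ → ℝ) (e : HilbertBasis ℕ ℝ H) (n : ℕ)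
    {F : H → H} (τ : ℝ≥0) (hG : Measurable (schemeDrift lam e n F τ)) :
    IsAutoregression P (fun m => ℱ (m * τ))
      (P.map fun ω => galerkinSemigroup lam e n τ (projIncrement e n W 0 τ ω))
      (schemeDrift lam e n F τ)
      (fun m ω => galerkinSemigroup lam e n τ (projIncrement e n W (m * τ) ((m + 1) * τ) ω))
      (scheme lam e n F W τ) := by
  have hE : Measurable (galerkinSemigroup lam e n τ) := (galerkinSemigroup lam e n τ).measurable
  have hle : ∀ m : ℕ, (m : ℝ≥0) * τ ≤ (m + 1) * τ := fun m => by gcongr; simp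
  have hmeas : ∀ {s t : ℝ≥0}, s ≤ t → Measurable (projIncrement e n W s t) := fun h =>
    (hW.adapted_projIncrement e n h).mono (ℱ.le _) le_rfl
  refine ⟨fun m k h => ℱ.mono (by gcongr), fun m => ℱ.le _, hG, fun m => ?_, fun m => ?_,
    fun m => ?_, fun x ω => rfl, fun x m ω => rfl⟩
  · rw [Nat.cast_succ]
    exact hE.comp (hW.adapted_projIncrement e n (hle m))
  · refine indep_of_indep_of_le_left (hW.indep_projIncrement e n (hle m)) ?_
    exact (hE.comp (comap_measurable _)).comap_le
  · have h1 : P.map (projIncrement e n W (m * τ) ((m + 1) * τ)) =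
        P.map (projIncrement e n W 0 τ) :=
      hW.map_projIncrement_eq e n (hle m) zero_le (by
        rw [add_mul, one_mul, add_tsub_cancel_left, tsub_zero])
    have h2 := Measure.map_map (μ := P) hE (hmeas (hle m))
    have h3 := Measure.map_map (μ := P) hE (hmeas (zero_le (a := τ)))
    rw [h1, h3] at h2
    exact h2.symm

end ExpEuler

theorem mainTheorem7
    {H : Type*} [NormedAddCommGroup H] [InnerProductSpace ℝ H] [CompleteSpace H]
    [TopologicalSpace.SeparableSpace H] [MeasurableSpace H] [BorelSpace H]
    {Ω : Type*} {mΩ : MeasurableSpace Ω} (P : Measure Ω) [IsProbabilityMeasure P]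
    (ℱ : Filtration ℝ≥0 mΩ)
    (A : H →ₗ.[ℝ] H) (hA : ExpEuler.IsNegSelfAdjointCompactInv A)
    (lam : ℕ → ℝ) (e : HilbertBasis ℕ ℝ H) (he : ExpEuler.IsEigenSystem A lam e)
    (β : ℝ) (hβ : β ∈ Set.Ioc (0 : ℝ) 1)
    (Q : H →L[ℝ] H) (hQ : ExpEuler.IsCovariance A lam e β Q)
    (W : ℝ≥0 → H → Ω → ℝ) (hW : ExpEuler.IsCylindricalWiener P ℱ Q W)
    (X₀ : H) (hX₀ : ExpEuler.MemHdot lam e (max (2 * β) 1) X₀)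
    (δ η L LF : ℝ) (hδ : δ ∈ Set.Ico (1 : ℝ) 2) (hη : η ∈ Set.Ico (0 : ℝ) 1)
    (F : H → H) (hF : ExpEuler.IsNonlinearity lam e δ η L LF F)
    (n : ℕ) (τ : ℝ≥0) (hτ : 0 < τ) (hτL : 4 * L ^ 2 * (τ : ℝ) < lam 0 - LF) :
    ExpEuler.IsMarkovChain P (fun m => ℱ (m * τ))
      (ExpEuler.transition P (ExpEuler.scheme lam e n F W τ))
      (ExpEuler.scheme lam e n F W τ (ExpEuler.galerkinProj e n X₀)) ∧
    ∃ ν : Measure (ExpEuler.galerkin e n),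
      ExpEuler.IsInvariantProb (ExpEuler.transition P (ExpEuler.scheme lam e n F W τ)) ν ∧
      ExpEuler.IsErgodicFor (ExpEuler.transition P (ExpEuler.scheme lam e n F W τ)) ν ∧
      ∀ μ : Measure (ExpEuler.galerkin e n),
        ExpEuler.IsInvariantProb (ExpEuler.transition P (ExpEuler.scheme lam e n F W τ)) μ →
        μ = ν := by
  obtain ⟨DF, -, hD, -, hDL, -, -⟩ := hF.deriv
  have hLip : ∀ x y, ‖F x - F y‖ ≤ L * ‖x - y‖ :=
    ExpEuler.norm_sub_le_of_hasLineDerivAt (DF := fun φ ψ => DF φ ψ) hD hDL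
  have hcontr := ExpEuler.norm_schemeDrift_sub_le e n he.mono τ.2 hF.oneSided hLip
  set q := Real.exp ((τ : ℝ) * (LF + τ * L ^ 2 / 2 - lam 0))
  have hq : 0 ≤ q := Real.exp_nonneg _
  -- This needs `τL²/2 < λ₁ - L_F`, which is weaker than the step size condition because `L²τ ≥ 0`.
  have hq1 : q < 1 := by
    refine Real.exp_zero ▸ Real.exp_lt_exp.2 (mul_neg_of_pos_of_neg (NNReal.coe_pos.2 hτ) ?_)
    have : 0 ≤ L ^ 2 * (τ : ℝ) := by positivity
    linarith
  have : SecondCountableTopology (ExpEuler.galerkin e n) := secondCountable_of_proper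
  have hdrift : Measurable (ExpEuler.schemeDrift lam e n F τ) :=
    (LipschitzWith.of_dist_le_mul (K := ⟨q, hq⟩) fun x y => by
      rw [dist_eq_norm, dist_eq_norm]; exact hcontr x y).continuous.measurable
  have hY := ExpEuler.isAutoregression_scheme hW lam e n τ hdrift
  have := hY.isProbabilityMeasure_law
  have hnoise : Integrable id (P.map fun ω => ExpEuler.galerkinSemigroup lam e n τ
      (ExpEuler.projIncrement e n W 0 τ ω)) := by
    have hint := (ExpEuler.galerkinSemigroup lam e n τ).integrable_comp
      (hW.integrable_projIncrement e n (zero_le (a := τ)))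
    exact (integrable_map_measure measurable_id.aestronglyMeasurable
      hint.aestronglyMeasurable.aemeasurable).2 hint
  obtain ⟨ν, hνp, hν⟩ := ExpEuler.exists_invariant_stepOp hnoise hq hq1 hcontr
  have hinv := hY.isInvariantProb_of_stepOp hν
  exact ⟨hY.isMarkovChain _, ν, hinv, hY.isErgodicFor hq hq1 hcontr hinv,
    fun μ hμ => hY.invariant_unique hq hq1 hcontr hinv hμ⟩
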